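/- Let $\mathcal{D}_n$ be the set of real $n\times n$ diagonal matrices, let $r(\cdot)$ denote the spectral radius, and call a matrix \emph{scalar} if it equals $cI$ for some $c\in\mathbb{R}$ and \emph{nonscalar} otherwise. A nonnegative $n \times n$ matrix $M$ is called \emph{irreducible} if for every pair of indices $(i,j)$ there is an integer $m\ge 1$ with $[M^m]_{ij}>0$. Let $A$ be a fixed entrywise nonnegative $n\times n$ real matrix with $r(A)>0$. Then: 1. For all $C,D\in\mathcal{D}_n$ and $t\in(0,1)$, $$\log r\bigl(e^{(1-t)C+tD}A\bigr)\le (1-t)\log r\bigl(e^{C}A\bigr)+t\log r\bigl(e^{D}A\bigr).\qquad(*)$$ 2. If $C,D\in\mathcal{D}_n$ and $C-D$ is scalar, then equality holds in $(*)$ for every $t\in(0,1)$. 3. The following are equivalent: (a) $A$ and $A^{\top}A$ are irreducible; (b) for all $C,D\in\mathcal{D}_n$, if equality holds in $(*)$ for some $t\in(0,1)$, then $C-D$ is scalar; (c) for all $C,D\in\mathcal{D}_n$ with $C-D$ nonscalar, strict inequality holds in $(*)$ for every $t\in(0,1)$. -/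

import Mathlib

/-- The spectral radius `r(A)` of a real square matrix: the maximum modulus of its complex
eigenvalues. (The spectrum of a matrix is finite, so the supremum in `spectralRadius` is finite
and nothing is lost in passing from `ℝ≥0∞` to `ℝ`.) -/
noncomputable def specRad {n : ℕ} (A : Matrix (Fin n) (Fin n) ℝ) : ℝ :=
  (spectralRadius ℂ (A.map (fun x : ℝ => (x : ℂ)))).toReal

/-- The function `D ↦ log r(e^D A)`, where `e^D` is the matrix exponential. -/
noncomputable def logRadExp {n : ℕ} (A D : Matrix (Fin n) (Fin n) ℝ) : ℝ :=
  Real.log (specRad (NormedSpace.exp D * A))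

/-- A scalar matrix: a real multiple `c I` of the identity. -/
def IsScalarMatrix {n : ℕ} (M : Matrix (Fin n) (Fin n) ℝ) : Prop :=
  ∃ c : ℝ, M = c • (1 : Matrix (Fin n) (Fin n) ℝ)

/-!
The spectral radius `r` of an entrywise nonnegative matrix `A` is controlled by two facts, which
replace the full Perron–Frobenius theorem. The moduli of a complex eigenvector for an eigenvalue
of maximal modulus form a nonzero `x ≥ 0` with `r x ≤ A x` (`exists_superinvariant`), and for
every `s > r` Gelfand's formula provides a strictly positive `y` with `A y ≤ s y`
(`exists_subinvariant`). Together with the comparison `le_of_superinvariant_of_subinvariant` they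
bound `r` from below by any `p` with `p x ≤ A x`, `0 ≠ x ≥ 0`, and from above by any `q` with
`A y ≤ q y`, `y > 0` (`le_specRad`, `specRad_le`).

*Convexity.* In logarithmic coordinates `y j = exp (α j)`, the inequality `e^D A y ≤ e^p y` reads
`∑ j, A i j * exp (α j) ≤ exp (p + α i - d i)` for all `i`. Solutions `(α, p, c)` and `(β, q, d)`
combine convexly to a solution, by convexity of `exp` applied in each row
(`sum_mul_exp_weighted_le`), and this is convexity of `d ↦ log r(e^D A)`
(`log_specRad_expScale_convex`).

*Equality.* If `A` is irreducible, then `α` and `β` may be taken from positive eigenvectors, and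
a positive subinvariant vector for the spectral radius is an eigenvector
(`Matrix.IsIrreducible.mulVec_eq_of_subinvariant`), so equality forces equality in every row.
Strict convexity of `exp` then shows that `α j - β j` takes one value on the support of each row.
Two columns meet in a row exactly when the corresponding entry of `Aᵀ A` is positive, so
irreducibility of `Aᵀ A` makes `α - β` constant, and the row equations make `c - d` constant
(`exists_const_of_log_specRad_eq`).

*Necessity.* If `A` is reducible, there is a superinvariant vector for `r(A)` with a vanishing
coordinate; shrinking the rows where it vanishes does not change the spectral radius
(`exists_ray_of_not_isIrreducible`). If `A` is irreducible but `Aᵀ A` is not, the columns split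
into two nonempty classes such that no row meets both. Scaling the columns of one class by `e^s`
multiplies each row by either `1` or `e^s`, which a diagonal matrix can undo
(`exists_ray_of_not_isIrreducible_transpose_mul`). In both cases `log r(e^{sD} A)` is constant in
`s ≥ 0` for some nonscalar `D`, so equality holds between `0` and `D`.
-/

/-! ### Sub- and superinvariant vectors and the spectral radius -/

section Comparison

variable {n : ℕ} {A : Matrix (Fin n) (Fin n) ℝ}

open Matrix Finset

theorem mulVec_mono_of_nonneg (hA : ∀ i j, 0 ≤ A i j) {x y : Fin n → ℝ} (h : x ≤ y) :
    A *ᵥ x ≤ A *ᵥ y :=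
  fun i => by
    simp only [mulVec, dotProduct]
    exact Finset.sum_le_sum fun j _ => mul_le_mul_of_nonneg_left (h j) (hA i j)

theorem mulVec_nonneg_of_nonneg (hA : ∀ i j, 0 ≤ A i j) {x : Fin n → ℝ} (hx : 0 ≤ x) :
    0 ≤ A *ᵥ x := by
  simpa using mulVec_mono_of_nonneg hA hx

/-- Scale `y` by the least `c` with `x ≤ c y` and compare both inequalities at a coordinate where
`x = c y`. -/
theorem le_of_superinvariant_of_subinvariant (hA : ∀ i j, 0 ≤ A i j) {x y : Fin n → ℝ}
    {p q : ℝ} (hx : 0 ≤ x) (hx0 : x ≠ 0) (hy : ∀ i, 0 < y i) (hpx : p • x ≤ A *ᵥ x)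
    (hqy : A *ᵥ y ≤ q • y) : p ≤ q := by
  obtain ⟨k, hk⟩ : ∃ k, x k ≠ 0 := by
    by_contra! h
    exact hx0 (funext h)
  obtain ⟨i, -, hi⟩ := Finset.exists_max_image univ (fun i => x i / y i) ⟨k, mem_univ k⟩
  set c := x i / y i with hc
  have hxc : x ≤ c • y := fun j => by
    have := hi j (mem_univ j)
    rwa [div_le_iff₀ (hy j)] at this
  have hxi : x i = c * y i := by
    rw [hc, div_mul_cancel₀ _ (hy i).ne']
  have hc0 : 0 < c :=
    (div_pos (lt_of_le_of_ne (hx k) (Ne.symm hk)) (hy k)).trans_le (hi k (mem_univ k))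
  have hxi0 : 0 < x i := hxi ▸ mul_pos hc0 (hy i)
  have h1 : p * x i ≤ c * (q * y i) :=
    (hpx i).trans <| (mulVec_mono_of_nonneg hA hxc i).trans <| by
      rw [mulVec_smul]
      exact mul_le_mul_of_nonneg_left (hqy i) hc0.le
  refine le_of_mul_le_mul_right (h1.trans_eq ?_) hxi0
  rw [hxi]; ring

attribute [local instance] Matrix.linftyOpNormedRing Matrix.linftyOpNormedAlgebra

/-- Finiteness of the spectral radius, so that `specRad` does not take the junk value `0` of
`ENNReal.toReal` at `⊤`. -/
theorem spectralRadius_map_ne_top (A : Matrix (Fin n) (Fin n) ℝ) :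
    spectralRadius ℂ (A.map (fun x : ℝ => (x : ℂ))) ≠ ⊤ := by
  have h := spectrum.spectralRadius_le_pow_nnnorm_pow_one_div ℂ
    (A.map (fun x : ℝ => (x : ℂ))) 0
  refine ne_top_of_le_ne_top ?_ h
  simp [ENNReal.mul_eq_top]

/-- The vector consists of the moduli of an eigenvector whose eigenvalue has maximal modulus. -/
theorem exists_superinvariant [Nonempty (Fin n)] (hA : ∀ i j, 0 ≤ A i j) :
    ∃ x : Fin n → ℝ, 0 ≤ x ∧ x ≠ 0 ∧ specRad A • x ≤ A *ᵥ x := by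
  obtain ⟨z, hz, hzr⟩ := spectrum.exists_nnnorm_eq_spectralRadius
    (A.map (fun x : ℝ => (x : ℂ)))
  have hr : specRad A = ‖z‖ := by
    rw [specRad, ← hzr]; simp
  rw [spectrum.mem_iff, Matrix.isUnit_iff_isUnit_det, isUnit_iff_ne_zero, not_not,
    ← Matrix.exists_mulVec_eq_zero_iff] at hz
  obtain ⟨v, hv0, hv⟩ := hz
  refine ⟨fun i => ‖v i‖, fun i => norm_nonneg _, fun h => hv0 ?_, fun i => ?_⟩
  · ext i
    simpa using congrFun h i
  · have hvi : z * v i = ∑ j, (A i j : ℂ) * v j := by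
      have := congrFun hv i
      rw [sub_mulVec, Algebra.algebraMap_eq_smul_one, smul_mulVec, one_mulVec] at this
      simpa [sub_eq_zero, mulVec, dotProduct] using this
    calc specRad A * ‖v i‖ = ‖z * v i‖ := by rw [hr, norm_mul]
      _ ≤ ∑ j, ‖(A i j : ℂ) * v j‖ := by rw [hvi]; exact norm_sum_le _ _
      _ = ∑ j, A i j * ‖v j‖ := by
        refine Finset.sum_congr rfl fun j _ => ?_
        rw [norm_mul, Complex.norm_real, Real.norm_of_nonneg (hA i j)]

/-- A consequence of Gelfand's formula for the `ℓ^∞` operator norm, that is, the maximal row sum. -/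
theorem exists_pow_mulVec_one_le {s : ℝ} (hs : specRad A < s) :
    ∃ N : ℕ, 0 < N ∧ (A ^ N) *ᵥ 1 ≤ (s ^ N) • 1 := by
  have hs0 : 0 < s := ENNReal.toReal_nonneg.trans_lt hs
  have hlt : spectralRadius ℂ (A.map (fun x : ℝ => (x : ℂ))) < ENNReal.ofReal s :=
    (ENNReal.lt_ofReal_iff_toReal_lt (spectralRadius_map_ne_top A)).2 hs
  have hev := (spectrum.pow_norm_pow_one_div_tendsto_nhds_spectralRadius
    (A.map (fun x : ℝ => (x : ℂ)))).eventually (gt_mem_nhds hlt)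
  obtain ⟨N, hN, hN0⟩ := (hev.and (Filter.eventually_gt_atTop 0)).exists
  refine ⟨N, hN0, fun i => ?_⟩
  have h1 : ‖(A.map (fun x : ℝ => (x : ℂ))) ^ N‖ ≤ s ^ N := by
    have h2 := ((ENNReal.ofReal_lt_ofReal_iff hs0).1 hN).le
    rwa [one_div, Real.rpow_inv_le_iff_of_pos (norm_nonneg _) hs0.le (by exact_mod_cast hN0),
      Real.rpow_natCast] at h2
  have h3 : (A.map (fun x : ℝ => (x : ℂ))) ^ N = (A ^ N).map (fun x : ℝ => (x : ℂ)) :=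
    (Matrix.map_pow A Complex.ofRealHom N).symm
  rw [h3] at h1
  have h4 : ‖(A ^ N).map (fun x : ℝ => (x : ℂ)) *ᵥ 1‖ ≤ s ^ N := by
    have : Nonempty (Fin n) := ⟨i⟩
    refine (Matrix.linfty_opNorm_mulVec _ _).trans ?_
    rwa [norm_one, mul_one]
  have h5 := (norm_le_pi_norm _ i).trans h4
  have h6 : ((A ^ N).map (fun x : ℝ => (x : ℂ)) *ᵥ 1) i = (((A ^ N *ᵥ 1) i : ℝ) : ℂ) := by
    simp [mulVec, dotProduct]
  rw [h6, Complex.norm_real] at h5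
  simpa using (Real.le_norm_self _).trans h5

/-- The vector is the truncated Neumann series `∑ k < N, s⁻ᵏ Aᵏ 1`. It is subinvariant as soon as
`Aᴺ 1 ≤ sᴺ 1`, because the sum telescopes. -/
theorem exists_subinvariant (hA : ∀ i j, 0 ≤ A i j) {s : ℝ} (hs : specRad A < s) :
    ∃ y : Fin n → ℝ, (∀ i, 0 < y i) ∧ A *ᵥ y ≤ s • y := by
  have hs0 : 0 < s := ENNReal.toReal_nonneg.trans_lt hs
  obtain ⟨N, hN0, hN⟩ := exists_pow_mulVec_one_le hs
  set B := s⁻¹ • A with hB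
  have hBnn : ∀ i j, 0 ≤ B i j := fun i j => mul_nonneg (inv_nonneg.2 hs0.le) (hA i j)
  have hAB : A = s • B := by rw [hB, smul_smul, mul_inv_cancel₀ hs0.ne', one_smul]
  have hBN : B ^ N *ᵥ 1 ≤ 1 := fun i => by
    have := hN i
    rw [hAB, smul_pow, smul_mulVec] at this
    exact le_of_mul_le_mul_left this (pow_pos hs0 N)
  refine ⟨(∑ k ∈ range N, B ^ k) *ᵥ 1, fun i => ?_, ?_⟩
  · rw [sum_mulVec, Finset.sum_apply]
    refine Finset.sum_pos' (fun k _ => mulVec_nonneg_of_nonneg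
      (pow_apply_nonneg hBnn k) zero_le_one i) ⟨0, by simpa using hN0, by simp⟩
  · have h1 : B *ᵥ ((∑ k ∈ range N, B ^ k) *ᵥ 1) =
        (∑ k ∈ range N, B ^ k) *ᵥ 1 + (B ^ N *ᵥ 1 - 1) := by
      have h := mul_geom_sum B N
      rw [sub_mul, one_mul, sub_eq_iff_eq_add'] at h
      rw [mulVec_mulVec, h, add_mulVec, sub_mulVec, one_mulVec]
    rw [hAB, smul_mulVec, h1]
    refine smul_le_smul_of_nonneg_left ?_ hs0.le
    simpa using hBN

theorem le_specRad (hA : ∀ i j, 0 ≤ A i j) {x : Fin n → ℝ} {p : ℝ} (hx : 0 ≤ x) (hx0 : x ≠ 0)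
    (h : p • x ≤ A *ᵥ x) : p ≤ specRad A := by
  refine le_of_forall_gt_imp_ge_of_dense fun s hs => ?_
  obtain ⟨y, hy, hys⟩ := exists_subinvariant hA hs
  exact le_of_superinvariant_of_subinvariant hA hx hx0 hy h hys

theorem specRad_le [Nonempty (Fin n)] (hA : ∀ i j, 0 ≤ A i j) {y : Fin n → ℝ} {q : ℝ}
    (hy : ∀ i, 0 < y i) (h : A *ᵥ y ≤ q • y) : specRad A ≤ q := by
  obtain ⟨x, hx, hx0, hxr⟩ := exists_superinvariant hA
  exact le_of_superinvariant_of_subinvariant hA hx hx0 hy hxr h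

theorem specRad_eq_of_mulVec_eq [Nonempty (Fin n)] (hA : ∀ i j, 0 ≤ A i j) {y : Fin n → ℝ}
    {q : ℝ} (hy : ∀ i, 0 < y i) (h : A *ᵥ y = q • y) : specRad A = q :=
  (specRad_le hA hy h.le).antisymm <| le_specRad hA (fun i => (hy i).le)
    (fun h0 => (hy (Classical.arbitrary _)).ne' (congrFun h0 _)) h.ge

/-- Monotonicity of the spectral radius on entrywise nonnegative matrices. -/
theorem specRad_mono [Nonempty (Fin n)] {B : Matrix (Fin n) (Fin n) ℝ}
    (hA : ∀ i j, 0 ≤ A i j) (hAB : ∀ i j, A i j ≤ B i j) : specRad A ≤ specRad B := by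
  obtain ⟨x, hx, hx0, hxr⟩ := exists_superinvariant hA
  refine le_specRad (fun i j => (hA i j).trans (hAB i j)) hx hx0 (hxr.trans fun i => ?_)
  simp only [mulVec, dotProduct]
  exact Finset.sum_le_sum fun j _ => mul_le_mul_of_nonneg_right (hAB i j) (hx j)

theorem specRad_smul [Nonempty (Fin n)] (hA : ∀ i j, 0 ≤ A i j) {c : ℝ} (hc : 0 < c) :
    specRad (c • A) = c * specRad A := by
  have key : ∀ {c : ℝ} {A : Matrix (Fin n) (Fin n) ℝ}, (∀ i j, 0 ≤ A i j) → 0 < c →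
      c * specRad A ≤ specRad (c • A) := by
    intro c A hA hc
    obtain ⟨x, hx, hx0, hxr⟩ := exists_superinvariant hA
    refine le_specRad (fun i j => mul_nonneg hc.le (hA i j)) hx hx0 ?_
    change _ ≤ (c • A) *ᵥ x
    rw [smul_mulVec, mul_smul]
    exact smul_le_smul_of_nonneg_left hxr hc.le
  refine le_antisymm ?_ (key hA hc)
  have h := key (c := c⁻¹) (A := c • A) (fun i j => mul_nonneg hc.le (hA i j)) (inv_pos.2 hc)
  rw [smul_smul, inv_mul_cancel₀ hc.ne', one_smul] at h
  rwa [inv_mul_le_iff₀ hc] at h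

end Comparison

/-! ### Irreducible matrices -/

section Irreducible

open Matrix Finset

variable {n : ℕ} {A : Matrix (Fin n) (Fin n) ℝ}

/-- A positive polynomial in `A`: it commutes with `A` and turns nonzero nonnegative vectors into
strictly positive ones. -/
theorem Matrix.IsIrreducible.exists_sum_pow_pos (hA : A.IsIrreducible) :
    ∃ N : ℕ, ∀ i j, 0 < (∑ k ∈ range N, A ^ k) i j := by
  have h := (isIrreducible_iff_exists_pow_pos hA.nonneg).1 hA
  choose K hK0 hK using h
  refine ⟨(∑ i, ∑ j, K i j) + 1, fun i j => ?_⟩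
  have hle : K i j ≤ ∑ i, ∑ j, K i j :=
    (Finset.single_le_sum (f := fun j => K i j) (fun _ _ => Nat.zero_le _) (mem_univ j)).trans
      (Finset.single_le_sum (f := fun i => ∑ j, K i j) (fun _ _ => Nat.zero_le _) (mem_univ i))
  rw [Matrix.sum_apply]
  exact Finset.sum_pos' (fun k _ => pow_apply_nonneg hA.nonneg k i j)
    ⟨K i j, mem_range.2 (Nat.lt_succ_of_le hle), hK i j⟩

theorem mulVec_pos_of_pos {Q : Matrix (Fin n) (Fin n) ℝ} (hQ : ∀ i j, 0 < Q i j)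
    {f : Fin n → ℝ} (hf : 0 ≤ f) (hf0 : f ≠ 0) (i : Fin n) : 0 < (Q *ᵥ f) i := by
  obtain ⟨k, hk⟩ : ∃ k, f k ≠ 0 := by
    by_contra! h
    exact hf0 (funext h)
  exact Finset.sum_pos' (fun j _ => mul_nonneg (hQ i j).le (hf j))
    ⟨k, mem_univ k, mul_pos (hQ i k) (lt_of_le_of_ne (hf k) (Ne.symm hk))⟩

theorem exists_pos_smul_le [Nonempty (Fin n)] {f y : Fin n → ℝ} (hf : ∀ i, 0 < f i)
    (hy : ∀ i, 0 < y i) : ∃ ε : ℝ, 0 < ε ∧ ε • y ≤ f := by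
  obtain ⟨i, hi⟩ := Finite.exists_min (fun i => f i / y i)
  exact ⟨f i / y i, div_pos (hf i) (hy i), fun j => (le_div_iff₀ (hy j)).1 (hi j)⟩

/-- If `A x ≠ r x`, then applying a positive polynomial in `A` to `x` gives a vector `y` with
`(r + ε) y ≤ A y`, which contradicts `le_specRad`. -/
theorem Matrix.IsIrreducible.pos_and_mulVec_eq_of_superinvariant (hA : A.IsIrreducible)
    {x : Fin n → ℝ} (hx : 0 ≤ x) (hx0 : x ≠ 0) (h : specRad A • x ≤ A *ᵥ x) :
    (∀ i, 0 < x i) ∧ A *ᵥ x = specRad A • x := by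
  obtain ⟨N, hQ⟩ := hA.exists_sum_pow_pos
  set Q := ∑ k ∈ range N, A ^ k with hQdef
  have hcomm : A * Q = Q * A := (Commute.sum_right _ _ _ fun k _ => Commute.self_pow A k).eq
  have hy := mulVec_pos_of_pos hQ hx hx0
  have hne : Nonempty (Fin n) := by
    by_contra h0
    rw [not_nonempty_iff] at h0
    exact hx0 (Subsingleton.elim _ _)
  have heq : A *ᵥ x = specRad A • x := by
    by_contra hne'
    have hf := mulVec_pos_of_pos hQ (sub_nonneg.2 h) (sub_ne_zero.2 hne')
    obtain ⟨ε, hε, hεy⟩ := exists_pos_smul_le hf hy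
    refine (lt_add_of_pos_right (specRad A) hε).not_ge
      (le_specRad hA.nonneg (x := Q *ᵥ x) (fun i => (hy i).le) ?_ ?_)
    · exact fun h0 => (hy (Classical.arbitrary _)).ne' (congrFun h0 _)
    · rw [mulVec_sub, mulVec_smul, mulVec_mulVec, ← hcomm, ← mulVec_mulVec] at hεy
      rw [add_smul]
      simpa [add_comm] using add_le_of_le_sub_right hεy
  refine ⟨fun i => ?_, heq⟩
  have hpow : ∀ k : ℕ, A ^ k *ᵥ x = specRad A ^ k • x := by
    intro k
    induction k with
    | zero => simp
    | succ k ih => rw [pow_succ, ← mulVec_mulVec, heq, mulVec_smul, ih, smul_smul, pow_succ']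
  refine lt_of_le_of_ne (hx i) fun h0 => (hy i).ne' ?_
  rw [hQdef, sum_mulVec, Finset.sum_apply]
  refine Finset.sum_eq_zero fun k _ => ?_
  rw [hpow, Pi.smul_apply, ← h0, smul_zero]

theorem Matrix.IsIrreducible.exists_pos_mulVec_eq [Nonempty (Fin n)] (hA : A.IsIrreducible) :
    ∃ x : Fin n → ℝ, (∀ i, 0 < x i) ∧ A *ᵥ x = specRad A • x := by
  obtain ⟨x, hx, hx0, hxr⟩ := exists_superinvariant hA.nonneg
  exact ⟨x, hA.pos_and_mulVec_eq_of_superinvariant hx hx0 hxr⟩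

theorem Matrix.IsIrreducible.mulVec_eq_of_subinvariant (hA : A.IsIrreducible)
    {x : Fin n → ℝ} (hx : ∀ i, 0 < x i) (h : A *ᵥ x ≤ specRad A • x) :
    A *ᵥ x = specRad A • x := by
  by_contra hne'
  have hne : Nonempty (Fin n) := by
    by_contra h0
    rw [not_nonempty_iff] at h0
    exact hne' (Subsingleton.elim _ _)
  obtain ⟨N, hQ⟩ := hA.exists_sum_pow_pos
  set Q := ∑ k ∈ range N, A ^ k
  have hcomm : A * Q = Q * A := (Commute.sum_right _ _ _ fun k _ => Commute.self_pow A k).eq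
  have hy := mulVec_pos_of_pos hQ (fun i => (hx i).le)
    (fun h0 => (hx (Classical.arbitrary _)).ne' (congrFun h0 _))
  have hf := mulVec_pos_of_pos hQ (sub_nonneg.2 h) (sub_ne_zero.2 (Ne.symm hne'))
  obtain ⟨ε, hε, hεy⟩ := exists_pos_smul_le hf hy
  refine (sub_lt_self (specRad A) hε).not_ge (specRad_le hA.nonneg hy ?_)
  rw [mulVec_sub, mulVec_smul, mulVec_mulVec, ← hcomm, ← mulVec_mulVec] at hεy
  rw [sub_smul]
  exact le_sub_comm.1 hεy

/-- A function that is constant along the edges of the graph of an irreducible matrix is constant. -/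
theorem Matrix.IsIrreducible.eq_of_forall_pos {α : Type*} (hA : A.IsIrreducible) {f : Fin n → α}
    (hf : ∀ i j, 0 < A i j → f i = f j) (i j : Fin n) : f i = f j := by
  have key : ∀ (k : ℕ) (j : Fin n), 0 < (A ^ k) i j → f i = f j := by
    intro k
    induction k with
    | zero =>
      intro j h
      by_cases hij : i = j
      · rw [hij]
      · simp [Matrix.one_apply_ne hij] at h
    | succ k ih =>
      intro j h
      rw [pow_succ, mul_apply] at h
      obtain ⟨l, -, hl⟩ := (Finset.sum_pos_iff_of_nonneg fun l _ =>
        mul_nonneg (pow_apply_nonneg hA.nonneg k i l) (hA.nonneg l j)).1 h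
      exact (ih l (pos_of_mul_pos_left hl (hA.nonneg l j))).trans
        (hf l j (pos_of_mul_pos_right hl (pow_apply_nonneg hA.nonneg k i l)))
  obtain ⟨k, -, hk⟩ := (isIrreducible_iff_exists_pow_pos hA.nonneg).1 hA i j
  exact key k j hk

/-- Irreducibility asks for paths of positive length, so the set of indices reachable from a given
one may be empty; this happens exactly when its row vanishes. -/
theorem exists_closed_or_zero_row_of_not_isIrreducible (hA : ∀ i j, 0 ≤ A i j)
    (h : ¬ A.IsIrreducible) :
    (∃ S : Set (Fin n), S.Nonempty ∧ Sᶜ.Nonempty ∧ ∀ i ∈ S, ∀ j ∉ S, A i j = 0) ∨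
      ∃ i, ∀ j, A i j = 0 := by
  rw [isIrreducible_iff_exists_pow_pos hA] at h
  push Not at h
  obtain ⟨i, j, hij⟩ := h
  by_cases hrow : ∀ l, A i l = 0
  · exact Or.inr ⟨i, hrow⟩
  push Not at hrow
  obtain ⟨l, hl⟩ := hrow
  refine Or.inl ⟨{l | ∃ k > 0, 0 < (A ^ k) i l}, ⟨l, 1, one_pos, ?_⟩, ⟨j, ?_⟩, ?_⟩
  · rw [pow_one]
    exact lt_of_le_of_ne (hA i l) (Ne.symm hl)
  · rintro ⟨k, hk, hpos⟩
    exact hpos.not_ge (hij k hk)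
  · rintro a ⟨k, hk, ha⟩ b hb
    by_contra hab
    refine hb ⟨k + 1, Nat.succ_pos k, ?_⟩
    rw [pow_succ, mul_apply]
    exact Finset.sum_pos' (fun c _ => mul_nonneg (pow_apply_nonneg hA k i c) (hA c b))
      ⟨a, mem_univ a, mul_pos ha (lt_of_le_of_ne (hA a b) (Ne.symm hab))⟩

end Irreducible

/-! ### Weighted sums of exponentials -/

section RowInequality

theorem exp_weighted_le {t : ℝ} (ht : t ∈ Set.Ioo (0 : ℝ) 1) (a b : ℝ) :
    Real.exp ((1 - t) * a + t * b) ≤ (1 - t) * Real.exp a + t * Real.exp b := by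
  simpa using convexOn_exp.2 (Set.mem_univ a) (Set.mem_univ b) (sub_nonneg.2 ht.2.le) ht.1.le
    (by ring)

theorem exp_weighted_lt {t : ℝ} (ht : t ∈ Set.Ioo (0 : ℝ) 1) {a b : ℝ} (hab : a ≠ b) :
    Real.exp ((1 - t) * a + t * b) < (1 - t) * Real.exp a + t * Real.exp b := by
  simpa using strictConvexOn_exp.2 (Set.mem_univ a) (Set.mem_univ b) hab (sub_pos.2 ht.2) ht.1
    (by ring)

variable {ι : Type*} [Fintype ι] {a α β : ι → ℝ} {P Q t : ℝ}

theorem sum_mul_exp_sub_le_one (h : ∑ j, a j * Real.exp (α j) ≤ Real.exp P) :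
    ∑ j, a j * Real.exp (α j - P) ≤ 1 := by
  simp_rw [Real.exp_sub, ← mul_div_assoc, ← Finset.sum_div]
  exact (div_le_one (Real.exp_pos P)).2 h

theorem sum_weighted_le_one (hα : ∑ j, a j * Real.exp (α j) ≤ Real.exp P)
    (hβ : ∑ j, a j * Real.exp (β j) ≤ Real.exp Q) (ht : t ∈ Set.Ioo (0 : ℝ) 1) :
    ∑ j, a j * ((1 - t) * Real.exp (α j - P) + t * Real.exp (β j - Q)) ≤ 1 := by
  have h : ∑ j, a j * ((1 - t) * Real.exp (α j - P) + t * Real.exp (β j - Q)) =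
      (1 - t) * ∑ j, a j * Real.exp (α j - P) + t * ∑ j, a j * Real.exp (β j - Q) := by
    rw [Finset.mul_sum, Finset.mul_sum, ← Finset.sum_add_distrib]
    exact Finset.sum_congr rfl fun j _ => by ring
  have h1 := mul_le_mul_of_nonneg_left (sum_mul_exp_sub_le_one hα) (sub_nonneg.2 ht.2.le)
  have h2 := mul_le_mul_of_nonneg_left (sum_mul_exp_sub_le_one hβ) ht.1.le
  rw [h]; linarith

theorem sum_mul_exp_weighted_eq : ∑ j, a j * Real.exp ((1 - t) * α j + t * β j) =
    (∑ j, a j * Real.exp ((1 - t) * (α j - P) + t * (β j - Q))) *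
      Real.exp ((1 - t) * P + t * Q) := by
  rw [Finset.sum_mul]
  refine Finset.sum_congr rfl fun j _ => ?_
  rw [mul_assoc, ← Real.exp_add]
  congr 2; ring

/-- Hölder's inequality in exponential coordinates. -/
theorem sum_mul_exp_weighted_le (ha : ∀ j, 0 ≤ a j)
    (hα : ∑ j, a j * Real.exp (α j) ≤ Real.exp P)
    (hβ : ∑ j, a j * Real.exp (β j) ≤ Real.exp Q) (ht : t ∈ Set.Ioo (0 : ℝ) 1) :
    ∑ j, a j * Real.exp ((1 - t) * α j + t * β j) ≤ Real.exp ((1 - t) * P + t * Q) := by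
  rw [sum_mul_exp_weighted_eq (P := P) (Q := Q)]
  refine mul_le_of_le_one_left (Real.exp_pos _).le (le_trans ?_ (sum_weighted_le_one hα hβ ht))
  exact Finset.sum_le_sum fun j _ => mul_le_mul_of_nonneg_left (exp_weighted_le ht _ _) (ha j)

/-- The equality case of `sum_mul_exp_weighted_le`. -/
theorem sub_eq_sub_of_sum_mul_exp_weighted_eq (ha : ∀ j, 0 ≤ a j)
    (hα : ∑ j, a j * Real.exp (α j) ≤ Real.exp P)
    (hβ : ∑ j, a j * Real.exp (β j) ≤ Real.exp Q) (ht : t ∈ Set.Ioo (0 : ℝ) 1)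
    (h : ∑ j, a j * Real.exp ((1 - t) * α j + t * β j) = Real.exp ((1 - t) * P + t * Q))
    {j : ι} (hj : 0 < a j) : α j - P = β j - Q := by
  by_contra hne
  rw [sum_mul_exp_weighted_eq (P := P) (Q := Q), mul_eq_right₀ (Real.exp_pos _).ne'] at h
  refine (h.symm.trans_lt (lt_of_lt_of_le ?_ (sum_weighted_le_one hα hβ ht))).false
  exact Finset.sum_lt_sum
    (fun j _ => mul_le_mul_of_nonneg_left (exp_weighted_le ht _ _) (ha j))
    ⟨j, Finset.mem_univ j, mul_lt_mul_of_pos_left (exp_weighted_lt ht hne) hj⟩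

end RowInequality

/-! ### Diagonal scalings -/

section DiagonalScaling

open Matrix

variable {n : ℕ} {A : Matrix (Fin n) (Fin n) ℝ}

/-- The matrix `e^D A` for the diagonal matrix `D` with diagonal `d`: row `i` of `A` is multiplied
by `exp (d i)`. -/
noncomputable def expScale (A : Matrix (Fin n) (Fin n) ℝ) (d : Fin n → ℝ) :
    Matrix (Fin n) (Fin n) ℝ :=
  Matrix.of fun i j => Real.exp (d i) * A i j

@[simp]
theorem expScale_apply (d : Fin n → ℝ) (i j : Fin n) :
    expScale A d i j = Real.exp (d i) * A i j := rfl

theorem exp_diagonal_mul (d : Fin n → ℝ) :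
    NormedSpace.exp (diagonal d) * A = expScale A d := by
  ext i j
  rw [Matrix.exp_diagonal, diagonal_mul, Pi.coe_exp, ← Real.exp_eq_exp_ℝ, expScale_apply]

theorem logRadExp_diagonal (d : Fin n → ℝ) :
    logRadExp A (diagonal d) = Real.log (specRad (expScale A d)) := by
  rw [logRadExp, exp_diagonal_mul]

theorem expScale_nonneg (hA : ∀ i j, 0 ≤ A i j) (d : Fin n → ℝ) (i j : Fin n) :
    0 ≤ expScale A d i j := mul_nonneg (Real.exp_pos _).le (hA i j)

theorem expScale_mulVec (d x : Fin n → ℝ) (i : Fin n) :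
    (expScale A d *ᵥ x) i = Real.exp (d i) * (A *ᵥ x) i := by
  simp only [mulVec, dotProduct, expScale_apply, Finset.mul_sum, mul_assoc]

theorem expScale_zero : expScale A 0 = A := by
  ext i j; simp

theorem expScale_add_const (d : Fin n → ℝ) (c : ℝ) :
    expScale A (fun i => d i + c) = Real.exp c • expScale A d := by
  ext i j
  rw [Matrix.smul_apply, expScale_apply, expScale_apply, Real.exp_add, smul_eq_mul]
  ring

theorem nonempty_of_specRad_pos (hr : 0 < specRad A) : Nonempty (Fin n) := by
  by_contra h
  rw [not_nonempty_iff] at h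
  rw [specRad, spectrum.SpectralRadius.of_subsingleton] at hr
  simp at hr

theorem specRad_expScale_pos (hA : ∀ i j, 0 ≤ A i j) (hr : 0 < specRad A) (d : Fin n → ℝ) :
    0 < specRad (expScale A d) := by
  have hne := nonempty_of_specRad_pos hr
  obtain ⟨k, hk⟩ := Finite.exists_min d
  refine (mul_pos (Real.exp_pos (d k)) hr).trans_le ?_
  rw [← specRad_smul hA (Real.exp_pos _)]
  refine specRad_mono (fun i j => mul_nonneg (Real.exp_pos _).le (hA i j)) fun i j => ?_
  exact mul_le_mul_of_nonneg_right (Real.exp_le_exp.2 (hk i)) (hA i j)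

theorem log_specRad_expScale_add_const (hA : ∀ i j, 0 ≤ A i j) (hr : 0 < specRad A)
    (d : Fin n → ℝ) (c : ℝ) : Real.log (specRad (expScale A fun i => d i + c)) =
      Real.log (specRad (expScale A d)) + c := by
  have hne := nonempty_of_specRad_pos hr
  rw [expScale_add_const, specRad_smul (expScale_nonneg hA d) (Real.exp_pos c),
    Real.log_mul (Real.exp_pos c).ne' (specRad_expScale_pos hA hr d).ne', Real.log_exp, add_comm]

/-- Subinvariance of a positive vector, in logarithmic coordinates. -/
theorem expScale_mulVec_exp_le_iff {d α : Fin n → ℝ} {p : ℝ} {i : Fin n} :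
    (expScale A d *ᵥ fun j => Real.exp (α j)) i ≤ Real.exp p * Real.exp (α i) ↔
      ∑ j, A i j * Real.exp (α j) ≤ Real.exp (p + α i - d i) := by
  rw [expScale_mulVec, Real.exp_sub, Real.exp_add, le_div_iff₀ (Real.exp_pos _), mul_comm]
  rfl

theorem exists_sum_mul_exp_le (hA : ∀ i j, 0 ≤ A i j) (hr : 0 < specRad A) {d : Fin n → ℝ}
    {p : ℝ} (hp : Real.log (specRad (expScale A d)) < p) :
    ∃ α : Fin n → ℝ, ∀ i, ∑ j, A i j * Real.exp (α j) ≤ Real.exp (p + α i - d i) := by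
  obtain ⟨y, hy, h⟩ := exists_subinvariant (expScale_nonneg hA d)
    ((Real.log_lt_iff_lt_exp (specRad_expScale_pos hA hr d)).1 hp)
  refine ⟨fun i => Real.log (y i), fun i => expScale_mulVec_exp_le_iff.1 ?_⟩
  simpa only [Real.exp_log (hy _), Pi.smul_apply, smul_eq_mul] using h i

theorem log_specRad_le_of_sum_mul_exp_le (hA : ∀ i j, 0 ≤ A i j) (hr : 0 < specRad A)
    {d α : Fin n → ℝ} {p : ℝ}
    (h : ∀ i, ∑ j, A i j * Real.exp (α j) ≤ Real.exp (p + α i - d i)) :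
    Real.log (specRad (expScale A d)) ≤ p := by
  have hne := nonempty_of_specRad_pos hr
  rw [Real.log_le_iff_le_exp (specRad_expScale_pos hA hr d)]
  exact specRad_le (expScale_nonneg hA d) (fun i => Real.exp_pos (α i))
    fun i => expScale_mulVec_exp_le_iff.2 (h i)

/-- Convexity of `d ↦ log r(e^D A)` on diagonal matrices. -/
theorem log_specRad_expScale_convex (hA : ∀ i j, 0 ≤ A i j) (hr : 0 < specRad A)
    (c d : Fin n → ℝ) {t : ℝ} (ht : t ∈ Set.Ioo (0 : ℝ) 1) :
    Real.log (specRad (expScale A fun i => (1 - t) * c i + t * d i)) ≤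
      (1 - t) * Real.log (specRad (expScale A c)) + t * Real.log (specRad (expScale A d)) := by
  refine le_of_forall_pos_le_add fun ε hε => ?_
  obtain ⟨α, hα⟩ := exists_sum_mul_exp_le hA hr (lt_add_of_pos_right
    (Real.log (specRad (expScale A c))) hε)
  obtain ⟨β, hβ⟩ := exists_sum_mul_exp_le hA hr (lt_add_of_pos_right
    (Real.log (specRad (expScale A d))) hε)
  refine log_specRad_le_of_sum_mul_exp_le hA hr (α := fun i => (1 - t) * α i + t * β i)
    fun i => (sum_mul_exp_weighted_le (hA i) (hα i) (hβ i) ht).trans_eq ?_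
  congr 1; ring

theorem expScale_isIrreducible (hA : A.IsIrreducible) (d : Fin n → ℝ) :
    (expScale A d).IsIrreducible := by
  refine ⟨expScale_nonneg hA.nonneg d, ?_⟩
  have : (expScale A d).toQuiver = A.toQuiver := by
    simp [toQuiver, mul_pos_iff_of_pos_left, Real.exp_pos]
  rw [this]
  exact hA.connected

/-- The positive eigenvector of `e^D A`, in logarithmic coordinates. -/
theorem exists_sum_mul_exp_eq (hA : A.IsIrreducible) (hr : 0 < specRad A) (d : Fin n → ℝ) :
    ∃ α : Fin n → ℝ, ∀ i, ∑ j, A i j * Real.exp (α j) =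
      Real.exp (Real.log (specRad (expScale A d)) + α i - d i) := by
  have hne := nonempty_of_specRad_pos hr
  obtain ⟨x, hx, h⟩ := (expScale_isIrreducible hA d).exists_pos_mulVec_eq
  refine ⟨fun i => Real.log (x i), fun i => ?_⟩
  have hi := congrFun h i
  rw [expScale_mulVec, Pi.smul_apply, smul_eq_mul] at hi
  rw [Real.exp_sub, Real.exp_add, Real.exp_log (specRad_expScale_pos hA.nonneg hr d),
    Real.exp_log (hx i), eq_div_iff (Real.exp_pos _).ne', mul_comm, ← hi]
  simp only [Real.exp_log (hx _)]
  rfl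

/-- The equality case of `log_specRad_expScale_convex` when `A` and `Aᵀ A` are irreducible. -/
theorem exists_const_of_log_specRad_eq (hA : A.IsIrreducible)
    (hAA : (A.transpose * A).IsIrreducible) (hr : 0 < specRad A) {c d : Fin n → ℝ} {t : ℝ}
    (ht : t ∈ Set.Ioo (0 : ℝ) 1)
    (h : Real.log (specRad (expScale A fun i => (1 - t) * c i + t * d i)) =
      (1 - t) * Real.log (specRad (expScale A c)) + t * Real.log (specRad (expScale A d))) :
    ∃ k : ℝ, ∀ i, c i - d i = k := by
  have hnn := hA.nonneg
  obtain ⟨i₀⟩ := nonempty_of_specRad_pos hr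
  obtain ⟨α, hα⟩ := exists_sum_mul_exp_eq hA hr c
  obtain ⟨β, hβ⟩ := exists_sum_mul_exp_eq hA hr d
  set p := Real.log (specRad (expScale A c))
  set q := Real.log (specRad (expScale A d))
  set e : Fin n → ℝ := fun i => (1 - t) * c i + t * d i with he
  set γ : Fin n → ℝ := fun i => (1 - t) * α i + t * β i with hγ
  have hexp : ∀ i, (1 - t) * (p + α i - c i) + t * (q + β i - d i) =
      ((1 - t) * p + t * q) + γ i - e i := fun i => by rw [hγ, he]; ring
  have hle : expScale A e *ᵥ (fun i => Real.exp (γ i)) ≤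
      specRad (expScale A e) • fun i => Real.exp (γ i) := fun i => by
    have h1 := sum_mul_exp_weighted_le (hnn i) (hα i).le (hβ i).le ht
    rw [hexp, ← h] at h1
    have h2 := expScale_mulVec_exp_le_iff.2 h1
    rwa [Real.exp_log (specRad_expScale_pos hnn hr e)] at h2
  have heq := (expScale_isIrreducible hA e).mulVec_eq_of_subinvariant
    (fun i => Real.exp_pos _) hle
  have hrow : ∀ i j, 0 < A i j → α j - (p + α i - c i) = β j - (q + β i - d i) := by
    intro i j hij
    refine sub_eq_sub_of_sum_mul_exp_weighted_eq (hnn i) (hα i).le (hβ i).le ht ?_ hij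
    have hi := congrFun heq i
    rw [expScale_mulVec, Pi.smul_apply, smul_eq_mul] at hi
    rw [hexp, ← h, Real.exp_sub, Real.exp_add, Real.exp_log (specRad_expScale_pos hnn hr e), ← hi,
      mul_div_cancel_left₀ _ (Real.exp_pos _).ne']
    rfl
  have hconst := hAA.eq_of_forall_pos (f := fun j => α j - β j) fun j k hjk => by
    rw [mul_apply] at hjk
    obtain ⟨i, -, hi⟩ := (Finset.sum_pos_iff_of_nonneg fun i _ =>
      mul_nonneg (hnn i j) (hnn i k)).1 hjk
    have h1 := hrow i j (pos_of_mul_pos_left hi (hnn i k))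
    have h2 := hrow i k (pos_of_mul_pos_right hi (hnn i j))
    linarith
  refine ⟨p - q, fun i => ?_⟩
  -- Row `i` has a positive entry, so its row equation relates `c i - d i` to the constant `α - β`.
  obtain ⟨j, -, hj⟩ := (Finset.sum_pos_iff_of_nonneg fun j _ =>
    mul_nonneg (hnn i j) (Real.exp_pos (α j)).le).1 ((hα i).symm ▸ Real.exp_pos _)
  have h1 := hrow i j (pos_of_mul_pos_left hj (Real.exp_pos _).le)
  have h2 : α j - β j = α i - β i := hconst j i
  linarith

/-- For reducible `A`, the spectral radius is constant along some nonscalar diagonal ray. -/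
theorem exists_ray_of_not_isIrreducible (hA : ∀ i j, 0 ≤ A i j) (hr : 0 < specRad A)
    (h : ¬ A.IsIrreducible) : ∃ d : Fin n → ℝ, (¬ ∃ k : ℝ, ∀ i, d i = k) ∧
      ∀ s : ℝ, 0 ≤ s → specRad (expScale A fun i => s * d i) = specRad A := by
  have hne := nonempty_of_specRad_pos hr
  obtain ⟨x, hx, hx0, hxr⟩ := exists_superinvariant hA
  -- On a closed set `S` of indices, `A` sees only the restriction of `x` to `S`, so this restriction
  -- is superinvariant unless it is zero, and then `x` itself vanishes on `S`.
  obtain ⟨z, hz, hz0, ⟨k, hk⟩, hzr⟩ : ∃ z : Fin n → ℝ, 0 ≤ z ∧ z ≠ 0 ∧ (∃ k, z k = 0) ∧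
      specRad A • z ≤ A *ᵥ z := by
    classical
    rcases exists_closed_or_zero_row_of_not_isIrreducible hA h with ⟨S, hS, ⟨k, hk⟩, hS0⟩ | ⟨i, hi⟩
    · by_cases hxS : ∀ i ∈ S, x i = 0
      · obtain ⟨i, hi⟩ := hS
        exact ⟨x, hx, hx0, ⟨i, hxS i hi⟩, hxr⟩
      · push Not at hxS
        obtain ⟨i, hi, hxi⟩ := hxS
        have hz : (0 : Fin n → ℝ) ≤ S.indicator x := Set.indicator_nonneg fun i _ => hx i
        refine ⟨S.indicator x, hz, fun h0 => hxi ?_, ⟨k, Set.indicator_of_notMem hk x⟩,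
          fun i => ?_⟩
        · simpa [hi] using congrFun h0 i
        · by_cases hi : i ∈ S
          · have h1 : (A *ᵥ S.indicator x) i = (A *ᵥ x) i := by
              simp only [mulVec, dotProduct]
              refine Finset.sum_congr rfl fun j _ => ?_
              by_cases hj : j ∈ S
              · rw [Set.indicator_of_mem hj]
              · rw [hS0 i hi j hj, zero_mul, zero_mul]
            rw [h1, Pi.smul_apply, Set.indicator_of_mem hi]
            exact hxr i
          · rw [Pi.smul_apply, Set.indicator_of_notMem hi, smul_zero]
            exact mulVec_nonneg_of_nonneg hA hz i
    · refine ⟨x, hx, hx0, ⟨i, ?_⟩, hxr⟩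
      have h1 : specRad A * x i ≤ 0 := (hxr i).trans_eq (by simp [mulVec, dotProduct, hi])
      exact le_antisymm (nonpos_of_mul_nonpos_right h1 hr) (hx i)
  classical
  refine ⟨fun i => if z i = 0 then (-1 : ℝ) else 0, ?_, fun s hs => le_antisymm ?_ ?_⟩
  · rintro ⟨c, hc⟩
    refine hz0 (funext fun i => ?_)
    by_contra hi
    have h1 : (if z i = 0 then (-1 : ℝ) else 0) = c := hc i
    have h2 : (if z k = 0 then (-1 : ℝ) else 0) = c := hc k
    rw [if_neg (show z i ≠ 0 from hi)] at h1
    rw [if_pos hk] at h2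
    linarith
  · refine specRad_mono (expScale_nonneg hA _) fun i j => ?_
    refine mul_le_of_le_one_left (hA i j) (Real.exp_le_one_iff.2 ?_)
    dsimp only
    split_ifs <;> linarith
  · refine le_specRad (expScale_nonneg hA _) hz hz0 fun i => ?_
    rw [expScale_mulVec]
    by_cases hi : z i = 0
    · rw [Pi.smul_apply, hi, smul_zero]
      exact mul_nonneg (Real.exp_pos _).le (mulVec_nonneg_of_nonneg hA hz i)
    · simpa [hi] using hzr i

/-- For irreducible `A` with `Aᵀ A` reducible, the spectral radius is constant along some nonscalar
diagonal ray. -/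
theorem exists_ray_of_not_isIrreducible_transpose_mul (hA : A.IsIrreducible)
    (hr : 0 < specRad A) (h : ¬ (A.transpose * A).IsIrreducible) :
    ∃ d : Fin n → ℝ, (¬ ∃ k : ℝ, ∀ i, d i = k) ∧
      ∀ s : ℝ, 0 ≤ s → specRad (expScale A fun i => s * d i) = specRad A := by
  classical
  have hnn := hA.nonneg
  have hne := nonempty_of_specRad_pos hr
  have hAA : ∀ i j, 0 ≤ (A.transpose * A) i j := fun i j => by
    rw [mul_apply]
    exact Finset.sum_nonneg fun l _ => mul_nonneg (hnn l i) (hnn l j)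
  have hsupp : ∀ i j k, A i j ≠ 0 → (A.transpose * A) j k = 0 → A i k = 0 := by
    intro i j k hij hjk
    rw [mul_apply] at hjk
    have h1 := (Finset.sum_eq_zero_iff_of_nonneg fun l _ => mul_nonneg (hnn l j) (hnn l k)).1
      hjk i (Finset.mem_univ i)
    exact (mul_eq_zero.1 h1).resolve_left hij
  have hcol : ∀ j, ∃ i, A i j ≠ 0 := by
    intro j
    obtain ⟨m, hm, hpos⟩ := (isIrreducible_iff_exists_pow_pos hnn).1 hA j j
    by_contra! h0
    obtain ⟨m, rfl⟩ := Nat.exists_eq_succ_of_ne_zero hm.ne'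
    rw [pow_succ, mul_apply] at hpos
    simp [h0] at hpos
  obtain ⟨S, ⟨a, ha⟩, ⟨b, hb⟩, hS⟩ : ∃ S : Set (Fin n), S.Nonempty ∧ Sᶜ.Nonempty ∧
      ∀ i ∈ S, ∀ j ∉ S, (A.transpose * A) i j = 0 := by
    refine (exists_closed_or_zero_row_of_not_isIrreducible hAA h).resolve_right ?_
    rintro ⟨j, hj⟩
    obtain ⟨i, hi⟩ := hcol j
    exact hi (hsupp i j j hi (hj j))
  obtain ⟨u, hu, hur⟩ := hA.exists_pos_mulVec_eq
  set g : Fin n → ℝ := fun i => if i ∈ S then 0 else 1 with hg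
  set f : Fin n → ℝ := fun i => if ∃ j ∉ S, A i j ≠ 0 then 1 else 0 with hf
  -- Each row is supported in `S` or in its complement, and `f` records which.
  have hgf : ∀ i j, A i j ≠ 0 → g j = f i := by
    intro i j hij
    by_cases hj : j ∈ S
    · have : ¬ ∃ k ∉ S, A i k ≠ 0 := by
        rintro ⟨k, hk, hik⟩
        exact hik (hsupp i j k hij (hS j hj k hk))
      simp only [hg, hf, if_pos hj, if_neg this]
    · simp only [hg, hf, if_neg hj, if_pos (⟨j, hj, hij⟩ : ∃ k ∉ S, A i k ≠ 0)]
  have hray : ∀ s : ℝ, specRad (expScale A fun i => s * (g i - f i)) = specRad A := by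
    intro s
    refine specRad_eq_of_mulVec_eq (expScale_nonneg hnn _)
      (y := fun i => Real.exp (s * g i) * u i) (fun i => mul_pos (Real.exp_pos _) (hu i)) ?_
    ext i
    have h1 : (A *ᵥ fun j => Real.exp (s * g j) * u j) i = Real.exp (s * f i) * (A *ᵥ u) i := by
      simp only [mulVec, dotProduct, Finset.mul_sum]
      refine Finset.sum_congr rfl fun j _ => ?_
      by_cases hij : A i j = 0
      · simp [hij]
      · rw [hgf i j hij]; ring
    rw [expScale_mulVec, h1, hur, Pi.smul_apply, Pi.smul_apply, smul_eq_mul, smul_eq_mul,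
      mul_sub, Real.exp_sub]
    have := (Real.exp_pos (s * f i)).ne'
    field_simp
  refine ⟨fun i => g i - f i, ?_, fun s _ => hray s⟩
  rintro ⟨c, hc⟩
  have hc0 : c = 0 := by
    have h1 := log_specRad_expScale_add_const hnn hr 0 c
    have h2 := hray 1
    simp only [one_mul, hc] at h2
    simp only [Pi.zero_apply, zero_add] at h1
    rw [h2, expScale_zero] at h1
    linarith
  -- If `g - f` is constant, it is zero, and then `g` is constant along the edges of `A`, although it
  -- separates `S` from its complement.
  have hgA : ∀ i j, 0 < A i j → g i = g j := fun i j hij => by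
    rw [hgf i j hij.ne', ← sub_eq_zero]
    exact (hc i).trans hc0
  have := hA.eq_of_forall_pos hgA a b
  simp only [hg, if_pos ha, if_neg hb] at this
  exact zero_ne_one this

end DiagonalScaling

/-! ### The logarithm of the spectral radius on diagonal matrices -/

theorem isScalarMatrix_diagonal_sub_iff {n : ℕ} {c d : Fin n → ℝ} :
    IsScalarMatrix (Matrix.diagonal c - Matrix.diagonal d) ↔ ∃ k : ℝ, ∀ i, c i - d i = k := by
  refine exists_congr fun k => ?_
  rw [Matrix.diagonal_sub, Matrix.smul_one_eq_diagonal, Matrix.diagonal_injective.eq_iff,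
    funext_iff]

theorem logRadExp_weighted {n : ℕ} {A : Matrix (Fin n) (Fin n) ℝ} (c d : Fin n → ℝ) (t : ℝ) :
    logRadExp A ((1 - t) • Matrix.diagonal c + t • Matrix.diagonal d) =
      Real.log (specRad (expScale A fun i => (1 - t) * c i + t * d i)) := by
  rw [← logRadExp_diagonal, ← Matrix.diagonal_smul, ← Matrix.diagonal_smul, Matrix.diagonal_add]
  rfl

theorem exists_ray_of_not_irreducible_pair {n : ℕ} {A : Matrix (Fin n) (Fin n) ℝ}
    (hA : ∀ i j, 0 ≤ A i j) (hr : 0 < specRad A)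
    (h : ¬ (A.IsIrreducible ∧ (A.transpose * A).IsIrreducible)) :
    ∃ d : Fin n → ℝ, (¬ ∃ k : ℝ, ∀ i, d i = k) ∧
      ∀ s : ℝ, 0 ≤ s → specRad (expScale A fun i => s * d i) = specRad A := by
  by_cases hirr : A.IsIrreducible
  · exact exists_ray_of_not_isIrreducible_transpose_mul hirr hr fun h' => h ⟨hirr, h'⟩
  · exact exists_ray_of_not_isIrreducible hA hr hirr

theorem mainTheorem2 (n : ℕ) (A : Matrix (Fin n) (Fin n) ℝ)
    (hA : ∀ i j, 0 ≤ A i j) (hr : 0 < specRad A) :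
    (∀ C D : Matrix (Fin n) (Fin n) ℝ, C.IsDiag → D.IsDiag → ∀ t ∈ Set.Ioo (0 : ℝ) 1,
      logRadExp A ((1 - t) • C + t • D) ≤ (1 - t) * logRadExp A C + t * logRadExp A D) ∧
    (∀ C D : Matrix (Fin n) (Fin n) ℝ, C.IsDiag → D.IsDiag → IsScalarMatrix (C - D) →
      ∀ t ∈ Set.Ioo (0 : ℝ) 1,
      logRadExp A ((1 - t) • C + t • D) = (1 - t) * logRadExp A C + t * logRadExp A D) ∧
    List.TFAE [
      A.IsIrreducible ∧ (A.transpose * A).IsIrreducible,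
      ∀ C D : Matrix (Fin n) (Fin n) ℝ, C.IsDiag → D.IsDiag → ∀ t ∈ Set.Ioo (0 : ℝ) 1,
        logRadExp A ((1 - t) • C + t • D) = (1 - t) * logRadExp A C + t * logRadExp A D →
          IsScalarMatrix (C - D),
      ∀ C D : Matrix (Fin n) (Fin n) ℝ, C.IsDiag → D.IsDiag → ¬ IsScalarMatrix (C - D) →
        ∀ t ∈ Set.Ioo (0 : ℝ) 1,
        logRadExp A ((1 - t) • C + t • D) < (1 - t) * logRadExp A C + t * logRadExp A D] := by
  have hconv : ∀ C D : Matrix (Fin n) (Fin n) ℝ, C.IsDiag → D.IsDiag → ∀ t ∈ Set.Ioo (0 : ℝ) 1,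
      logRadExp A ((1 - t) • C + t • D) ≤ (1 - t) * logRadExp A C + t * logRadExp A D := by
    intro C D hC hD t ht
    rw [← hC.diagonal_diag, ← hD.diagonal_diag, logRadExp_weighted, logRadExp_diagonal,
      logRadExp_diagonal]
    exact log_specRad_expScale_convex hA hr _ _ ht
  refine ⟨hconv, ?_, ?_⟩
  · intro C D hC hD h t ht
    rw [← hC.diagonal_diag, ← hD.diagonal_diag] at h ⊢
    obtain ⟨k, hk⟩ := isScalarMatrix_diagonal_sub_iff.1 h
    have hCD : C.diag = fun i => D.diag i + k := funext fun i => by rw [← hk i]; ring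
    have hE : (fun i => (1 - t) * C.diag i + t * D.diag i) =
        fun i => D.diag i + (1 - t) * k := funext fun i => by rw [hCD]; ring
    rw [logRadExp_weighted, logRadExp_diagonal, logRadExp_diagonal, hE, hCD,
      log_specRad_expScale_add_const hA hr, log_specRad_expScale_add_const hA hr]
    ring
  · tfae_have 1 → 2 := by
      rintro ⟨hirr, hirr'⟩ C D hC hD t ht h
      rw [← hC.diagonal_diag, ← hD.diagonal_diag, logRadExp_weighted, logRadExp_diagonal,
        logRadExp_diagonal] at h
      rw [← hC.diagonal_diag, ← hD.diagonal_diag]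
      exact isScalarMatrix_diagonal_sub_iff.2
        (exists_const_of_log_specRad_eq hirr hirr' hr ht h)
    tfae_have 2 → 3 := fun h C D hC hD hCD t ht =>
      lt_of_le_of_ne (hconv C D hC hD t ht) fun heq => hCD (h C D hC hD t ht heq)
    tfae_have 3 → 1 := by
      intro h
      by_contra hirr
      obtain ⟨d, hd, hray⟩ := exists_ray_of_not_irreducible_pair hA hr hirr
      have hns : ¬ IsScalarMatrix (Matrix.diagonal d - Matrix.diagonal (0 : Fin n → ℝ)) := by
        rw [isScalarMatrix_diagonal_sub_iff]
        simpa using hd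
      have hlt := h _ _ (Matrix.isDiag_diagonal d) (Matrix.isDiag_diagonal 0) hns (1 / 2)
        (by norm_num)
      have h1 := hray 1 zero_le_one
      have h2 := hray (1 - 1 / 2) (by norm_num)
      simp only [one_mul] at h1
      rw [logRadExp_weighted, logRadExp_diagonal, logRadExp_diagonal, expScale_zero, h1] at hlt
      simp only [Pi.zero_apply, mul_zero, add_zero, h2] at hlt
      linarith
    tfae_finish
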